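/- Let $E$ be a finite set and $k\in\mathbb N_0$. Let $\mathrm{Mat}_k(E)$ be the free abelian group on the matroids of rank $k$ with ground set $E$. For such a matroid $M$ let $P(M)=\mathrm{conv}\{\sum_{b\in B}e_b \mid B \text{ a basis of } M\}\subset\mathbb R^E$ be its base polytope and $\mathbb 1_{P(M)}$ the indicator function of $P(M)$. A group morphism $f:\mathrm{Mat}_k(E)\to G$ to an abelian group is called valuative if $\sum_M z_M\mathbb 1_{P(M)}= 0$ on $\mathbb R^E$ implies $f(\sum_M z_M M)=0$, for all integers $z_M$. Write $\mathbb Z[E]=\mathbb Z[t_e\mid e\in E]$ and $t_A=\prod_{e\in A}t_e$ for $A\subseteq E$, let $\mathrm{rk}_M$ be the rank function, $\mathrm{rk}(M)=\mathrm{rk}_M(E)$, and let $$\widehat T_M(x,y,r,s)=\sum_{S\subseteq E}(x-1)^{\mathrm{rk}(M)-\mathrm{rk}_M(S)}(y-1)^{|S|-\mathrm{rk}_M(S)}\prod_{e\in S}(1+rt_e)\prod_{e\in E\setminus S}(1+st_e)\in\mathbb Z[E][x,y,r,s]$$ be the equivariant Tutte polynomial of $M$. **Proposition.** Each of the following assignments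 on the matroids of rank $k$ with ground set $E$ extends to a valuative group morphism from $\mathrm{Mat}_k(E)$ to the indicated group. 1. $M\mapsto\widehat T_M(x,y,r,s)\in\mathbb Z[E][x,y,r,s]$. 2. The multivariate (Potts) Tutte polynomial $M\mapsto\widetilde Z_M(q,\mathbf v)=q^{-\mathrm{rk}(M)}\,\widehat T_M(q+1,2,1,0)|_{t_e:=v_e-1}\in R[v_e\mid e\in E]$, for every commutative ring $R$ and every unit $q\in R$ (for example a positive real number $q$ in $R=\mathbb R$, or the indeterminate $q$ in $R=\mathbb Z[q^{\pm1}]$). 3. $M\mapsto\widehat T_M(x,y,r,s)\in\mathbb Z[E]$, and, for every $A\subseteq E$, $M\mapsto$ the coefficient of $t_A$ in $\widehat T_M(x,y,r,s)\in \mathbb Z[E]$, for each $(x,y,r,s)$ among $(1,1,1,0)$, $(2,2,1,0)$, $(2,1,1,0)$, $(1,2,0,1)$, $(2,0,1,0)$, $(0,2,1,0)$. 4. For every $A\subseteq E$, the $\mathbb Z$-valued assignments: the number of bases of $M$ containing $A$; the constant $2^{|E\setminus A|}$; the number of independent sets of $M$ containing $A$; the number of spanning sets of $M$ disjoint from $A$.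 Moreover, for every $A\subseteq E$, the valuative morphisms $\mathrm{Mat}_k(E)\to\mathbb Z$ given by the coefficient of $t_A$ in $\widehat T_M(2,0,1,0)$ and in $\widehat T_M(0,2,1,0)$ extend the following numbers, defined when $M$ is the cycle matroid of a finite graph $\Gamma$ with edge set $E$ (loops and parallel edges are allowed, and every edge, including a loop, has two orientations): 5. for $(2,0,1,0)$ and $A$ independent in $M$: the number of orientations of $E\setminus A$ such that the orientation of all edges is acyclic no matter how the edges in $A$ are oriented; 6. for $(0,2,1,0)$ and $\Gamma$ connected: the number of orientations of $E\setminus A$ that are strongly connected if the edges in $A$ may be used in both directions. -/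

import Mathlib

namespace EquivariantTutte

open MvPolynomial

/-! ### Matroids of rank `k` on `E`, base polytopes, valuative morphisms -/

/-- Matroids of rank `k` with ground set `E` (the whole type `E`). -/
def RankMatroid (E : Type*) (k : ℕ) : Type _ :=
  {M : Matroid E // M.E = Set.univ ∧ M.eRank = k}

/-- `Mat_k(E)`: the free abelian group on the matroids of rank `k` with ground set `E`. -/
abbrev Mat (E : Type*) (k : ℕ) : Type _ := RankMatroid E k →₀ ℤ

/-- The base polytope `P(M) ⊆ ℝ^E`: the convex hull of the indicator vectors `∑_{b ∈ B} e_b` of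
the bases `B` of `M`. -/
def basePolytope {E : Type*} (M : Matroid E) : Set (E → ℝ) :=
  convexHull ℝ {p : E → ℝ | ∃ B : Set E, M.IsBase B ∧ p = B.indicator 1}

/-- A group morphism `f : Mat_k(E) → G` is valuative if `∑ z_M 1_{P(M)} = 0` on all of `ℝ^E`
implies `f (∑ z_M M) = 0`. -/
def IsValuative {E : Type*} {k : ℕ} {G : Type*} [AddCommGroup G] (f : Mat E k →+ G) : Prop :=
  ∀ z : Mat E k,
    (∀ p : E → ℝ, (z.sum fun M c => c * (basePolytope M.1).indicator (fun _ => (1 : ℤ)) p) = 0) →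
      f z = 0

/-- The assignment `φ` on matroids of rank `k` extends to a valuative group morphism. -/
def ExtendsToValuative {E : Type*} {k : ℕ} {G : Type*} [AddCommGroup G]
    (φ : RankMatroid E k → G) : Prop :=
  ∃ f : Mat E k →+ G, (∀ M, f (Finsupp.single M 1) = φ M) ∧ IsValuative f

/-! ### The equivariant and the multivariate Tutte polynomial -/

/-- The rank `rk_M(S)` as a natural number (on a finite ground set `eRk` is finite). -/
noncomputable def rk {E : Type*} (M : Matroid E) (S : Set E) : ℕ := (M.eRk S).toNat

/-- The equivariant Tutte polynomial `T̂_M(x,y,r,s)` in `ℤ[t_e | e ∈ E][x,y,r,s]`. The variables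
`x, y, r, s` are `X 0, X 1, X 2, X 3`, and `t_e` is the coefficient `C (X e)`. -/
noncomputable def equivTutte {E : Type*} [Fintype E] [DecidableEq E] (M : Matroid E) :
    MvPolynomial (Fin 4) (MvPolynomial E ℤ) :=
  ∑ S : Finset E,
    (X 0 - 1) ^ (rk M Set.univ - rk M S) * (X 1 - 1) ^ (S.card - rk M S) *
      (∏ e ∈ S, (1 + X 2 * C (X e))) * ∏ e ∈ Sᶜ, (1 + X 3 * C (X e))

/-- The evaluation `T̂_M(a 0, a 1, a 2, a 3) ∈ ℤ[t_e | e ∈ E]` at integers. -/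
noncomputable def evalTutte {E : Type*} [Fintype E] [DecidableEq E] (a : Fin 4 → ℤ)
    (M : Matroid E) : MvPolynomial E ℤ :=
  eval (fun i => C (a i)) (equivTutte M)

/-- The coefficient of `t_A = ∏_{e ∈ A} t_e` in `T̂_M(a 0, a 1, a 2, a 3)`. -/
noncomputable def evalCoeff {E : Type*} [Fintype E] [DecidableEq E] (a : Fin 4 → ℤ)
    (A : Finset E) (M : Matroid E) : ℤ :=
  coeff (∑ e ∈ A, Finsupp.single e 1) (evalTutte a M)

/-- The multivariate (Potts) Tutte polynomial
`Z̃_M(q, v) = q^{-rk M} T̂_M(q+1, 2, 1, 0)|_{t_e := v_e - 1}`, a polynomial in the `v_e` over any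
commutative ring in which `q` is invertible: positive real numbers `q` are an instance, and so is
the indeterminate `q` of a Laurent polynomial ring. -/
noncomputable def multivariateTutte {E : Type*} [Fintype E] [DecidableEq E] {R : Type*}
    [CommRing R] (q : Rˣ) (M : Matroid E) : MvPolynomial E R :=
  C (((q⁻¹ : Rˣ) : R) ^ rk M Set.univ) *
    eval₂ ((aeval fun e => (X e - 1 : MvPolynomial E R)) :
        MvPolynomial E ℤ →ₐ[ℤ] MvPolynomial E R).toRingHom
      ![C ((q : R) + 1), 2, 1, 0] (equivTutte M)

/-- The six points `(x, y, r, s)` of the table of evaluations. -/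
def tablePoints : Set (Fin 4 → ℤ) :=
  {![1, 1, 1, 0], ![2, 2, 1, 0], ![2, 1, 1, 0], ![1, 2, 0, 1], ![2, 0, 1, 0], ![0, 2, 1, 0]}

/-! ### Graphs, their cycle matroids and their orientations -/

/-- A graph with edge set `E` and vertex set `V`; loops and parallel edges are allowed. The two
ends of an edge are listed in an arbitrary order, which serves as a reference direction only
(so that every edge, a loop included, has exactly two orientations). -/
structure Multigraph (V E : Type*) where
  fst : E → V
  snd : E → V

namespace Multigraph

variable {V E : Type*}

/-- `u` and `v` are the two ends of some edge in `S`. -/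
def Adj (G : Multigraph V E) (S : Set E) (u v : V) : Prop :=
  ∃ e ∈ S, (G.fst e = u ∧ G.snd e = v) ∨ (G.snd e = u ∧ G.fst e = v)

/-- `u` and `v` are joined by a walk with edges in `S`. -/
def Joined (G : Multigraph V E) (S : Set E) : V → V → Prop :=
  Relation.ReflTransGen (G.Adj S)

/-- Any two vertices are joined by a walk. -/
def Connected (G : Multigraph V E) : Prop := ∀ u v, G.Joined Set.univ u v

/-- The edge set `S` contains no cycle: no edge of `S` has its ends joined by a walk in the rest
of `S`. -/
def IsForest (G : Multigraph V E) (S : Set E) : Prop :=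
  ∀ e ∈ S, ¬ G.Joined (S \ {e}) (G.fst e) (G.snd e)

/-- `M` is the cycle matroid of `G`: its ground set is the edge set, and its independent sets are
the sets of edges without cycles. -/
def IsCycleMatroid (G : Multigraph V E) (M : Matroid E) : Prop :=
  M.E = Set.univ ∧ ∀ S : Set E, M.Indep S ↔ G.IsForest S

/-- The edge `e`, oriented along (`b = true`) or against (`b = false`) its reference direction,
goes from `u` to `v`. -/
def GoesFromTo (G : Multigraph V E) (e : E) (b : Bool) (u v : V) : Prop :=
  if b then G.fst e = u ∧ G.snd e = v else G.snd e = u ∧ G.fst e = v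

/-- The orientation `o` of `G` has no directed cycle. -/
def IsAcyclicOrientation (G : Multigraph V E) (o : E → Bool) : Prop :=
  ∀ v, ¬ Relation.TransGen (fun u w => ∃ e, G.GoesFromTo e (o e) u w) v v

/-- The number of orientations of `E \ A` such that the orientation of all edges is acyclic, no
matter how the edges in `A` are oriented. -/
noncomputable def numAcyclic (G : Multigraph V E) (A : Set E) : ℕ :=
  Nat.card {o : {e // e ∉ A} → Bool //
    ∀ o' : E → Bool, (∀ e : {e // e ∉ A}, o' e = o e) → G.IsAcyclicOrientation o'}

/-- The number of orientations of `E \ A` that are strongly connected if the edges in `A` may be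
used in both directions. -/
noncomputable def numStronglyConnected (G : Multigraph V E) (A : Set E) : ℕ :=
  Nat.card {o : {e // e ∉ A} → Bool //
    ∀ u v, Relation.ReflTransGen
      (fun u w => (∃ e : {e // e ∉ A}, G.GoesFromTo e (o e) u w) ∨ G.Adj A u w) u v}

end Multigraph

end EquivariantTutte

namespace EquivariantTutte

open MvPolynomial

/-! ### Valuativity: from indicator relations to rank functions. -/

section

/-! ### Euler characteristic of families of compact convex sets -/

/-! All the assignments on matroids are built from sums `∑ S, F S (rk M S)`, because `rk M univ` is
the constant `k`. It therefore suffices that, for fixed `S` and `j`, the condition `rk M S = j` is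
valuative (`sum_rk_eq_zero`). Now `rk M S` is the maximum over `P(M)` of the functional `p ↦ ∑ e ∈
S, p e`. A relation among indicators of compact convex sets can be pushed forward along a linear
functional: slice by the level sets and apply the Euler characteristic, which is 1 on nonempty
compact convex sets. What remains is a relation among compact intervals, and subtracting its
right-hand limit at `b` from its value at `b` isolates the intervals with maximum `b`.

For graphs, the coefficient of `t_A` is a signed sum over `S ⊆ E \ A`. More generally, take two
disjoint kinds of edges, two-way edges `A` and oriented edges `F`, and count the orientations of `F`
in which no edge (`RelAcyclic`), or every edge (`RelCyclic`), of `F` lies on a closed walk. Moving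
an edge `e` out of `F` gives the deletion-contraction recursion `N(A, F + e) = N(A, F) + N(A + e,
F)`, unless `e` is a loop modulo `A` (acyclic case) or a bridge (cyclic case), when the count is 0.
The signed sums obey the same recursion (`sum_relAcyclic`, `sum_relCyclic`). -/

open Classical in
/-- If a linear combination of indicators of compact order-connected sets of reals vanishes, then
so does the sum of the coefficients of the sets with a prescribed largest element. -/
theorem sum_isGreatest_eq_zero {ι : Type*} (s : Finset ι) (z : ι → ℤ) (I : ι → Set ℝ)
    (hc : ∀ i, IsCompact (I i)) (ho : ∀ i, (I i).OrdConnected)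
    (h : ∀ t, ∑ i ∈ s, (if t ∈ I i then z i else 0) = 0) (b : ℝ) :
    ∑ i ∈ s, (if IsGreatest (I i) b then z i else 0) = 0 := by
  -- For an interval containing `b`, points just right of `b` are missing exactly when `b` is its
  -- maximum. For a closed set without `b`, they are missing as well.
  have key : ∀ i, ∀ᶠ t in nhdsWithin b (Set.Ioi b),
      (if IsGreatest (I i) b then z i else 0) =
        (if b ∈ I i then z i else 0) - (if t ∈ I i then z i else 0) := by
    intro i
    by_cases hb : b ∈ I i
    · by_cases hg : IsGreatest (I i) b
      · filter_upwards [self_mem_nhdsWithin] with t ht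
        have : t ∉ I i := fun h' => absurd (hg.2 h') (not_le.2 ht)
        simp [hb, hg, this]
      · obtain ⟨c, hcI, hbc⟩ : ∃ c ∈ I i, b < c := by
          by_contra! hcon
          exact hg ⟨hb, fun c hc => hcon c hc⟩
        filter_upwards [Ioo_mem_nhdsGT hbc] with t ht
        have : t ∈ I i := (ho i).out hb hcI ⟨ht.1.le, ht.2.le⟩
        simp [hb, hg, this]
    · have hg : ¬ IsGreatest (I i) b := fun h' => hb h'.1
      have : ∀ᶠ t in nhdsWithin b (Set.Ioi b), t ∉ I i :=
        nhdsWithin_le_nhds ((hc i).isClosed.isOpen_compl.mem_nhds hb)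
      filter_upwards [this] with t ht
      simp [hb, hg, ht]
  obtain ⟨t, ht⟩ := ((Filter.eventually_all_finset s).2 fun i _ => key i).exists
  rw [Finset.sum_congr rfl ht, Finset.sum_sub_distrib, h, h, sub_zero]

-- A nonempty compact set of reals has exactly one greatest element, so nonemptiness is a sum over
-- the possible maxima `b`.
open Classical in
theorem sum_nonempty_eq_zero {ι : Type*} (s : Finset ι) (z : ι → ℤ) (I : ι → Set ℝ)
    (hc : ∀ i, IsCompact (I i)) (ho : ∀ i, (I i).OrdConnected)
    (h : ∀ t, ∑ i ∈ s, (if t ∈ I i then z i else 0) = 0) :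
    ∑ i ∈ s, (if (I i).Nonempty then z i else 0) = 0 := by
  have key : ∀ i ∈ s, (if (I i).Nonempty then z i else 0) =
      ∑ b ∈ s.image (fun i => sSup (I i)), if IsGreatest (I i) b then z i else 0 := by
    intro i hi
    split_ifs with hn
    · have hg := (hc i).isGreatest_sSup hn
      rw [Finset.sum_eq_single_of_mem _ (Finset.mem_image_of_mem _ hi)]
      · simp [hg]
      · intro b _ hb
        rw [if_neg fun hb' => hb (hb'.unique hg)]
    · exact (Finset.sum_eq_zero fun b _ => if_neg fun hb => hn hb.nonempty).symm
  rw [Finset.sum_congr rfl key, Finset.sum_comm]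
  exact Finset.sum_eq_zero fun b _ => sum_isGreatest_eq_zero s z I hc ho h b

open Classical in
/-- The Euler characteristic is well defined on linear combinations of indicators of compact
convex sets. -/
theorem sum_compact_convex_nonempty_eq_zero {E ι : Type*} [Fintype E] (s : Finset ι) (z : ι → ℤ)
    (K : ι → Set (E → ℝ)) (hc : ∀ i, IsCompact (K i)) (ho : ∀ i, Convex ℝ (K i))
    (h : ∀ p, ∑ i ∈ s, (if p ∈ K i then z i else 0) = 0) :
    ∑ i ∈ s, (if (K i).Nonempty then z i else 0) = 0 := by
  -- `T` is the set of free coordinates. Freeing a coordinate `a` projects the larger slice to an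
  -- interval on the `a`-axis, whose fibres are slices covered by the induction hypothesis.
  suffices key : ∀ (T : Finset E) (t : E → ℝ),
      ∑ i ∈ s, (if (K i ∩ {p | ∀ e ∉ T, p e = t e}).Nonempty then z i else 0) = 0 by
    simpa using key Finset.univ 0
  intro T
  induction T using Finset.induction_on with
  | empty =>
    intro t
    refine Eq.trans ?_ (h t)
    refine Finset.sum_congr rfl fun i _ => if_congr ⟨?_, fun hp => ⟨t, hp, fun _ _ => rfl⟩⟩ rfl rfl
    rintro ⟨p, hp, hpt⟩
    rwa [← show p = t from funext fun e => hpt e (Finset.notMem_empty e)]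
  | insert a T ha ih =>
    intro t
    have hcl : IsClosed {p : E → ℝ | ∀ e ∉ insert a T, p e = t e} := by
      simp only [Set.ofPred_forall]
      exact isClosed_iInter fun e => isClosed_iInter fun _ =>
        isClosed_eq (continuous_apply e) continuous_const
    have hcv : Convex ℝ {p : E → ℝ | ∀ e ∉ insert a T, p e = t e} := by
      intro p hp q hq u v _ _ huv e he
      simp only [Pi.add_apply, Pi.smul_apply, smul_eq_mul, hp e he, hq e he]
      rw [← add_mul, huv, one_mul]
    have := sum_nonempty_eq_zero s z
      (fun i => (fun p : E → ℝ => p a) '' (K i ∩ {p | ∀ e ∉ insert a T, p e = t e}))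
      (fun i => ((hc i).inter_right hcl).image (continuous_apply a))
      (fun i => (((ho i).inter hcv).linear_image (LinearMap.proj a)).ordConnected) ?_
    · simpa only [Set.image_nonempty] using this
    · intro c
      refine Eq.trans ?_ (ih (Function.update t a c))
      refine Finset.sum_congr rfl fun i _ => if_congr ⟨?_, ?_⟩ rfl rfl
      · rintro ⟨p, ⟨hp, hpt⟩, rfl⟩
        refine ⟨p, hp, fun e he => ?_⟩
        by_cases hea : e = a
        · subst hea; simp
        · rw [Function.update_of_ne hea]
          exact hpt e (by simp [hea, he])
      · rintro ⟨p, hp, hpt⟩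
        refine ⟨p, ⟨hp, fun e he => ?_⟩, by simpa using hpt a ha⟩
        rw [Finset.mem_insert, not_or] at he
        simpa [Function.update_of_ne he.1] using hpt e he.2

-- A value `t` lies in `l '' K i` exactly when the slice of `K i` by `l p = t` is nonempty, so the
-- relation descends to the image intervals.
open Classical in
theorem sum_isGreatest_image_eq_zero {E ι : Type*} [Fintype E] (s : Finset ι) (z : ι → ℤ)
    (K : ι → Set (E → ℝ)) (hc : ∀ i, IsCompact (K i)) (ho : ∀ i, Convex ℝ (K i))
    (h : ∀ p, ∑ i ∈ s, (if p ∈ K i then z i else 0) = 0) (l : (E → ℝ) →ₗ[ℝ] ℝ) (b : ℝ) :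
    ∑ i ∈ s, (if IsGreatest (l '' K i) b then z i else 0) = 0 := by
  have hl : Continuous l := l.continuous_of_finiteDimensional
  refine sum_isGreatest_eq_zero s z _ (fun i => (hc i).image hl)
    (fun i => ((ho i).linear_image l).ordConnected) (fun t => ?_) b
  have := sum_compact_convex_nonempty_eq_zero s z (fun i => K i ∩ {p | l p = t})
    (fun i => (hc i).inter_right (isClosed_eq hl continuous_const))
    (fun i => (ho i).inter (convex_hyperplane l.isLinear t)) ?_
  · refine Eq.trans ?_ this
    exact Finset.sum_congr rfl fun i _ => if_congr Iff.rfl rfl rfl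
  · intro p
    by_cases hp : l p = t
    · simpa [hp] using h p
    · simp [hp]

/-! ### Valuative morphisms from rank functions -/

variable {E : Type*}

theorem cast_rk [Finite E] (M : Matroid E) (S : Set E) : (rk M S : ℕ∞) = M.eRk S :=
  ENat.natCast_toNat (M.isRkFinite_set S).eRk_lt_top.ne

theorem rk_mono [Finite E] (M : Matroid E) {S T : Set E} (h : S ⊆ T) : rk M S ≤ rk M T := by
  have := M.eRk_mono h
  rw [← cast_rk, ← cast_rk] at this
  exact_mod_cast this

theorem RankMatroid.rk_univ {k : ℕ} (M : RankMatroid E k) : rk M.1 Set.univ = k := by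
  rw [rk, Matroid.eRk_univ_eq, M.2.2, ENat.toNat_natCast]

theorem isCompact_basePolytope [Finite E] (M : Matroid E) : IsCompact (basePolytope M) := by
  refine Set.Finite.isCompact_convexHull (𝕜 := ℝ) (E := E → ℝ) ?_
  refine (Set.toFinite (Set.range fun B : Set E => B.indicator (1 : E → ℝ))).subset ?_
  rintro p ⟨B, -, rfl⟩
  exact ⟨B, rfl⟩

/-- The largest value of `∑_{e ∈ S} p_e` on the base polytope is the rank of `S`. -/
theorem isGreatest_image_basePolytope [Fintype E] [DecidableEq E] (M : Matroid E)
    (hM : M.E = Set.univ) (S : Finset E) :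
    IsGreatest ((∑ e ∈ S, LinearMap.proj e : (E → ℝ) →ₗ[ℝ] ℝ) '' basePolytope M) (rk M S) := by
  classical
  have hval : ∀ B : Set E, (∑ e ∈ S, LinearMap.proj e : (E → ℝ) →ₗ[ℝ] ℝ) (B.indicator 1) =
      ((S : Set E) ∩ B).ncard := by
    intro B
    have : ((S : Set E) ∩ B) = ((S.filter (· ∈ B) : Finset E) : Set E) := by ext; simp
    rw [this, Set.ncard_coe_finset]
    simp [Set.indicator_apply, LinearMap.sum_apply]
  have hcard : ∀ I : Set E, M.Indep I → I.ncard = rk M I := by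
    intro I hI
    rw [rk, hI.eRk_eq_encard, Set.ncard]
  constructor
  -- The maximum is attained at a base extending a basis `I` of `S`; maximality of `I` forces this
  -- base to meet `S` in `I` alone.
  · obtain ⟨I, hI⟩ := M.exists_isBasis (S : Set E) (by simp [hM])
    obtain ⟨B, hB, hIB⟩ := hI.indep.exists_isBase_superset
    refine ⟨B.indicator 1, subset_convexHull ℝ _ ⟨B, hB, rfl⟩, ?_⟩
    rw [hval, show (S : Set E) ∩ B = I from ?_, hcard I hI.indep, rk, hI.eRk_eq_eRk, rk]
    exact (hI.eq_of_subset_indep (hB.indep.subset Set.inter_subset_right)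
      (Set.subset_inter hI.subset hIB) Set.inter_subset_left).symm
  · rintro _ ⟨p, hp, rfl⟩
    refine convexHull_min (t := {p | (∑ e ∈ S, LinearMap.proj e : (E → ℝ) →ₗ[ℝ] ℝ) p ≤ rk M S})
      ?_ (convex_halfSpace_le (LinearMap.isLinear _) _) hp
    rintro _ ⟨B, hB, rfl⟩
    rw [Set.mem_ofPred_eq, hval, hcard _ (hB.indep.subset Set.inter_subset_right)]
    exact_mod_cast rk_mono M Set.inter_subset_left

theorem sum_rk_eq_zero [Fintype E] [DecidableEq E] {k : ℕ} (z : Mat E k)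
    (hz : ∀ p : E → ℝ,
      (z.sum fun M c => c * (basePolytope M.1).indicator (fun _ => (1 : ℤ)) p) = 0)
    (S : Finset E) (j : ℕ) :
    ∑ M ∈ z.support, (if rk M.1 (S : Set E) = j then z M else 0) = 0 := by
  classical
  refine Eq.trans ?_ (sum_isGreatest_image_eq_zero z.support z (fun M => basePolytope M.1)
    (fun M => isCompact_basePolytope M.1) (fun M => convex_convexHull ℝ _)
    (fun p => ?_) (∑ e ∈ S, LinearMap.proj e) j)
  · refine Finset.sum_congr rfl fun M _ => if_congr ⟨?_, fun h => ?_⟩ rfl rfl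
    · rintro rfl
      exact isGreatest_image_basePolytope M.1 M.2.1 S
    · exact_mod_cast (isGreatest_image_basePolytope M.1 M.2.1 S).unique h
  · refine Eq.trans ?_ (hz p)
    exact Finset.sum_congr rfl fun M _ => by simp [Set.indicator_apply]

/-- For each `S`, grouping the matroids by the value `j` of the rank turns the sum into multiples of
the vanishing sums of `sum_rk_eq_zero`. -/
theorem extendsToValuative_sum_rk [Fintype E] [DecidableEq E] {k : ℕ} {G : Type*} [AddCommGroup G]
    (F : Finset E → ℕ → G) :
    ExtendsToValuative fun M : RankMatroid E k => ∑ S : Finset E, F S (rk M.1 S) := by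
  refine ⟨Finsupp.liftAddHom fun M => (zmultiplesHom G) (∑ S : Finset E, F S (rk M.1 S)),
    fun M => by simp, fun z hz => ?_⟩
  rw [Finsupp.liftAddHom_apply, Finsupp.sum]
  simp only [zmultiplesHom_apply, Finset.smul_sum]
  rw [Finset.sum_comm]
  refine Finset.sum_eq_zero fun S _ => ?_
  have key : ∀ M ∈ z.support, z M • F S (rk M.1 S) =
      ∑ j ∈ z.support.image (fun M => rk M.1 S),
        (if rk M.1 (S : Set E) = j then z M else 0) • F S j := by
    intro M hM
    rw [Finset.sum_eq_single_of_mem _ (Finset.mem_image_of_mem _ hM)]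
    · simp
    · intro j _ hj
      simp [hj.symm]
  rw [Finset.sum_congr rfl key, Finset.sum_comm]
  refine Finset.sum_eq_zero fun j _ => ?_
  rw [← Finset.sum_smul, sum_rk_eq_zero z hz, zero_smul]

theorem ExtendsToValuative.comp {k : ℕ} {G H : Type*} [AddCommGroup G] [AddCommGroup H]
    {φ : RankMatroid E k → G} (h : ExtendsToValuative φ) (g : G →+ H) :
    ExtendsToValuative fun M => g (φ M) := by
  obtain ⟨f, hf, hv⟩ := h
  exact ⟨g.comp f, fun M => by simp [hf], fun z hz => by simp [hv z hz]⟩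

variable [Fintype E] [DecidableEq E] {k : ℕ}

theorem extendsToValuative_equivTutte :
    ExtendsToValuative fun M : RankMatroid E k => equivTutte M.1 := by
  simp only [equivTutte, RankMatroid.rk_univ]
  exact extendsToValuative_sum_rk fun S j =>
    ((X 0 - 1) ^ (k - j) * (X 1 - 1) ^ (S.card - j) *
      (∏ e ∈ S, (1 + X 2 * C (X e))) * ∏ e ∈ Sᶜ, (1 + X 3 * C (X e)) :
        MvPolynomial (Fin 4) (MvPolynomial E ℤ))

theorem extendsToValuative_multivariateTutte {R : Type*} [CommRing R] (q : Rˣ) :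
    ExtendsToValuative fun M : RankMatroid E k => multivariateTutte q M.1 := by
  simp only [multivariateTutte, RankMatroid.rk_univ]
  exact extendsToValuative_equivTutte.comp ((AddMonoidHom.mulLeft _).comp
    (eval₂Hom ((aeval fun e => (X e - 1 : MvPolynomial E R)) :
        MvPolynomial E ℤ →ₐ[ℤ] MvPolynomial E R).toRingHom
      ![C ((q : R) + 1), 2, 1, 0]).toAddMonoidHom)

theorem extendsToValuative_evalTutte (a : Fin 4 → ℤ) :
    ExtendsToValuative fun M : RankMatroid E k => evalTutte a M.1 :=
  extendsToValuative_equivTutte.comp (eval fun i => C (a i)).toAddMonoidHom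

theorem extendsToValuative_evalCoeff (a : Fin 4 → ℤ) (A : Finset E) :
    ExtendsToValuative fun M : RankMatroid E k => evalCoeff a A M.1 :=
  (extendsToValuative_evalTutte a).comp
    (lcoeff ℤ (∑ e ∈ A, Finsupp.single e 1)).toAddMonoidHom

/-- A number of sets that are recognized by their ranks is a valuative invariant. -/
theorem extendsToValuative_ncard (P : RankMatroid E k → Set E → Prop) (Q : Finset E → ℕ → Prop)
    (h : ∀ M (S : Finset E), P M S ↔ Q S (rk M.1 S)) :
    ExtendsToValuative fun M : RankMatroid E k => (({S | P M S}.ncard : ℕ) : ℤ) := by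
  classical
  convert extendsToValuative_sum_rk (k := k) (fun S j => if Q S j then (1 : ℤ) else 0) using 2 with M
  rw [Finset.sum_boole, Nat.cast_inj, ← Set.ncard_coe_finset]
  refine Set.ncard_congr (fun S _ => S.toFinset) (fun S hS => ?_) (fun S T _ _ h => by simpa using h)
    fun S hS => ⟨S, ?_, by simp⟩
  · simpa [← h] using hS
  · simpa [← h] using hS

theorem extendsToValuative_const (c : ℤ) : ExtendsToValuative fun _ : RankMatroid E k => c := by
  convert extendsToValuative_sum_rk (k := k) (fun S _ => if S = (∅ : Finset E) then c else 0) using 2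
  simp

theorem indep_iff_rk {E : Type*} [Fintype E] (M : Matroid E) (S : Finset E) : M.Indep S ↔ rk M S = S.card := by
  rw [Matroid.indep_iff_eRk_eq_encard_of_finite S.finite_toSet, ← cast_rk, Set.encard_coe_eq_coe_finsetCard, Nat.cast_inj]

theorem RankMatroid.spanning_iff_rk {E : Type*} [Fintype E] {k : ℕ} (M : RankMatroid E k) (S : Finset E) :
    M.1.Spanning S ↔ rk M.1 S = k := by
  rw [Matroid.spanning_iff_eRk_le (by simp [M.2.1]), (M.1.eRk_le_eRank _).ge_iff_eq, ← cast_rk,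
    M.2.2, Nat.cast_inj]

end

/-! ### Graphs: closure in the cycle matroid, and walks with two-way and oriented edges. -/

section

/-! ### Walks after adding a step -/

section Walks

open Relation

variable {V : Type*}

/-- The relation `R` together with one more step, from `x` to `y`. -/
def AddStep (R : V → V → Prop) (x y u v : V) : Prop := R u v ∨ (u = x ∧ v = y)

/-- A walk can be shortened so that it uses the new step at most once. -/
theorem reflTransGen_addStep {R : V → V → Prop} {x y a b : V} :
    ReflTransGen (AddStep R x y) a b ↔
      ReflTransGen R a b ∨ (ReflTransGen R a x ∧ ReflTransGen R y b) := by
  have hm : ∀ {u v}, ReflTransGen R u v → ReflTransGen (AddStep R x y) u v :=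
    ReflTransGen.mono (fun _ _ h => Or.inl h) _ _
  constructor
  · intro h
    induction h with
    | refl => exact Or.inl .refl
    | tail _ hs ih =>
      rcases hs with hs | ⟨rfl, rfl⟩
      · exact ih.imp (fun h => h.tail hs) fun h => ⟨h.1, h.2.tail hs⟩
      · exact Or.inr ⟨ih.elim id And.left, .refl⟩
  · rintro (h | ⟨h₁, h₂⟩)
    · exact hm h
    · exact ((hm h₁).tail (Or.inr ⟨rfl, rfl⟩)).trans (hm h₂)

/-- Describes walks after adding a two-way edge. The last two alternatives, where it is crossed
forth and back, follow from the first by transitivity. -/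
theorem reflTransGen_addStep_addStep {R : V → V → Prop} {x y a b : V} :
    ReflTransGen (AddStep (AddStep R x y) y x) a b ↔
      ReflTransGen R a b ∨ (ReflTransGen R a x ∧ ReflTransGen R y b) ∨
        (ReflTransGen R a y ∧ ReflTransGen R x b) ∨ (ReflTransGen R a x ∧ ReflTransGen R x b) ∨
        (ReflTransGen R a y ∧ ReflTransGen R y b) := by
  simp only [reflTransGen_addStep]
  have hr : ∀ v, ReflTransGen R v v := fun _ => .refl
  have ht : ∀ {u v w}, ReflTransGen R u v → ReflTransGen R v w → ReflTransGen R u w :=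
    fun h h' => h.trans h'
  constructor
  · rintro ((h | h) | ⟨h₁ | h₁, h₂ | h₂⟩) <;> tauto
  · rintro (h | h | h | h | h)
    · exact Or.inl (Or.inl h)
    · exact Or.inl (Or.inr h)
    · exact Or.inr ⟨Or.inl h.1, Or.inl h.2⟩
    · exact Or.inl (Or.inl (h.1.trans h.2))
    · exact Or.inl (Or.inl (h.1.trans h.2))

end Walks

namespace Multigraph

open Relation

variable {V E : Type*} (G : Multigraph V E)

/-! ### The closure operator of a cycle matroid -/

theorem adj_symm {S : Set E} {u v : V} (h : G.Adj S u v) : G.Adj S v u := by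
  obtain ⟨e, he, h | h⟩ := h
  · exact ⟨e, he, Or.inr h.symm⟩
  · exact ⟨e, he, Or.inl h.symm⟩

variable {G}

theorem Joined.symm {S : Set E} {u v : V} (h : G.Joined S u v) : G.Joined S v u := by
  induction h with
  | refl => exact .refl
  | tail _ hs ih => exact .head (G.adj_symm hs) ih

theorem Joined.mono {S T : Set E} {u v : V} (hST : S ⊆ T) (h : G.Joined S u v) : G.Joined T u v :=
  ReflTransGen.mono (fun _ _ ⟨e, he, h⟩ => ⟨e, hST he, h⟩) _ _ h

theorem joined_of_mem {S : Set E} {e : E} (he : e ∈ S) : G.Joined S (G.fst e) (G.snd e) :=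
  .single ⟨e, he, Or.inl ⟨rfl, rfl⟩⟩

theorem adj_insert (S : Set E) (e : E) :
    G.Adj (insert e S) = AddStep (AddStep (G.Adj S) (G.fst e) (G.snd e)) (G.snd e) (G.fst e) := by
  ext u v
  simp only [Adj, AddStep, Set.mem_insert_iff]
  constructor
  · rintro ⟨f, rfl | hf, ⟨rfl, rfl⟩ | ⟨rfl, rfl⟩⟩
    · exact Or.inl (Or.inr ⟨rfl, rfl⟩)
    · exact Or.inr ⟨rfl, rfl⟩
    · exact Or.inl (Or.inl ⟨f, hf, Or.inl ⟨rfl, rfl⟩⟩)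
    · exact Or.inl (Or.inl ⟨f, hf, Or.inr ⟨rfl, rfl⟩⟩)
  · rintro ((⟨f, hf, h⟩ | ⟨rfl, rfl⟩) | ⟨rfl, rfl⟩)
    · exact ⟨f, Or.inr hf, h⟩
    · exact ⟨e, Or.inl rfl, Or.inl ⟨rfl, rfl⟩⟩
    · exact ⟨e, Or.inl rfl, Or.inr ⟨rfl, rfl⟩⟩

theorem joined_insert {S : Set E} {e : E} {a b : V} (h : G.Joined (insert e S) a b) :
    G.Joined S a b ∨ (G.Joined S a (G.fst e) ∧ G.Joined S (G.snd e) b) ∨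
      (G.Joined S a (G.snd e) ∧ G.Joined S (G.fst e) b) := by
  rw [Joined, adj_insert, reflTransGen_addStep_addStep] at h
  rcases h with h | h | h | h | h
  · exact Or.inl h
  · exact Or.inr (Or.inl h)
  · exact Or.inr (Or.inr h)
  · exact Or.inl (h.1.trans h.2)
  · exact Or.inl (h.1.trans h.2)

theorem IsForest.subset {S T : Set E} (h : G.IsForest T) (hST : S ⊆ T) : G.IsForest S :=
  fun e he hj => h e (hST he) (hj.mono (Set.sdiff_subset_sdiff_left hST))

/-- An edge that closes a cycle with a forest joins two vertices of the same component. -/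
theorem IsForest.joined_of_insert {I : Set E} {e : E} (hI : G.IsForest I)
    (h : ¬ G.IsForest (insert e I)) : G.Joined I (G.fst e) (G.snd e) := by
  by_cases heI : e ∈ I
  · exact joined_of_mem heI
  simp only [IsForest, not_forall, not_not] at h
  obtain ⟨g, hg, hj⟩ := h
  rcases eq_or_ne g e with rfl | hge
  · simpa [heI] using hj
  have hgI : g ∈ I := hg.resolve_left hge
  have hm : ∀ {u v}, G.Joined (I \ {g}) u v → G.Joined I u v := fun h => h.mono Set.sdiff_subset
  have hgj : G.Joined I (G.fst g) (G.snd g) := joined_of_mem hgI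
  rw [← Set.insert_sdiff_singleton_comm hge.symm] at hj
  rcases joined_insert hj with h | ⟨h₁, h₂⟩ | ⟨h₁, h₂⟩
  · exact absurd h (hI g hgI)
  · exact (hm h₁).symm.trans (hgj.trans (hm h₂).symm)
  · exact (hm h₂).trans (hgj.symm.trans (hm h₁))

/-- For a forest `I`, adding `e` closes a cycle exactly when `I` joins its ends. A basis `I` of `X`
has the same closure, and each step along an edge of `X` can be replaced by a walk in `I`. -/
theorem IsCycleMatroid.mem_closure_iff {M : Matroid E} (h : G.IsCycleMatroid M) (X : Set E)
    (e : E) : e ∈ M.closure X ↔ G.Joined X (G.fst e) (G.snd e) := by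
  obtain ⟨I, hI⟩ := M.exists_isBasis X (by simp [h.1])
  have hF : G.IsForest I := (h.2 I).1 hI.indep
  have key : ∀ f, f ∈ M.closure I ↔ G.Joined I (G.fst f) (G.snd f) := by
    intro f
    by_cases hf : f ∈ I
    · exact ⟨fun _ => joined_of_mem hf, fun _ => M.mem_closure_of_mem hf⟩
    have := hI.indep.insert_indep_iff_of_notMem hf
    rw [h.2, h.1, Set.mem_sdiff, eq_true (Set.mem_univ f), true_and] at this
    constructor
    · intro hcl
      exact hF.joined_of_insert fun h' => this.1 h' hcl
    · intro hj
      by_contra hcl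
      exact this.2 hcl f (Set.mem_insert _ _) (by simpa [hf] using hj)
  rw [← hI.closure_eq_closure, key]
  refine ⟨fun hj => hj.mono hI.subset, ?_⟩
  generalize G.snd e = v
  intro hj
  induction hj with
  | refl => exact .refl
  | tail _ hs ih =>
    obtain ⟨f, hf, ⟨rfl, rfl⟩ | ⟨rfl, rfl⟩⟩ := hs
    · exact ih.trans ((key f).1 (hI.subset_closure hf))
    · exact ih.trans ((key f).1 (hI.subset_closure hf)).symm

theorem IsCycleMatroid.rk_insert_of_joined {M : Matroid E} (h : G.IsCycleMatroid M)
    {X : Set E} {e : E} (hj : G.Joined X (G.fst e) (G.snd e)) : rk M (insert e X) = rk M X := by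
  rw [rk, ← M.eRk_closure_eq, Matroid.closure_insert_eq_of_mem_closure
    ((h.mem_closure_iff X e).2 hj), M.eRk_closure_eq, rk]

theorem IsCycleMatroid.rk_insert_of_not_joined [Finite E] {M : Matroid E} (h : G.IsCycleMatroid M)
    {X : Set E} {e : E} (hj : ¬ G.Joined X (G.fst e) (G.snd e)) :
    rk M (insert e X) = rk M X + 1 := by
  have := Matroid.eRk_insert_eq_add_one (M := M) (e := e) (X := X)
    ⟨by simp [h.1], fun hcl => hj ((h.mem_closure_iff X e).1 hcl)⟩
  rw [← cast_rk, ← cast_rk] at this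
  exact_mod_cast this

/-! ### Orientations relative to a set of two-way edges -/

section Step

variable (G) (A F : Set E) (o : E → Bool)

/-- The starting vertex of the edge `e`, oriented by `b`. -/
def src (b : Bool) (e : E) : V := if b then G.fst e else G.snd e

/-- The final vertex of the edge `e`, oriented by `b`. -/
def tgt (b : Bool) (e : E) : V := if b then G.snd e else G.fst e

/-- One can go from `u` to `v` along an edge of `A`, in any direction, or along an edge of `F`,
in the direction given by `o`. -/
def Step (u v : V) : Prop := G.Adj A u v ∨ ∃ e ∈ F, G.src (o e) e = u ∧ G.tgt (o e) e = v

/-- No oriented edge in `F` lies on a closed walk. -/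
def RelAcyclic : Prop := ∀ e ∈ F, ¬ ReflTransGen (G.Step A F o) (G.tgt (o e) e) (G.src (o e) e)

/-- Every oriented edge in `F` lies on a closed walk. -/
def RelCyclic : Prop := ∀ e ∈ F, ReflTransGen (G.Step A F o) (G.tgt (o e) e) (G.src (o e) e)

end Step

theorem goesFromTo_iff (e : E) (b : Bool) (u v : V) :
    G.GoesFromTo e b u v ↔ G.src b e = u ∧ G.tgt b e = v := by
  cases b <;> simp [GoesFromTo, src, tgt]

theorem step_congr {A F : Set E} {o o' : E → Bool} (h : ∀ e ∈ F, o e = o' e) :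
    G.Step A F o = G.Step A F o' := by
  ext u v
  refine or_congr Iff.rfl (exists_congr fun e => and_congr_right fun he => by rw [h e he])

theorem relAcyclic_congr {A F : Set E} {o o' : E → Bool} (h : ∀ e ∈ F, o e = o' e) :
    G.RelAcyclic A F o ↔ G.RelAcyclic A F o' := by
  rw [RelAcyclic, RelAcyclic, step_congr h]
  exact forall₂_congr fun e he => by rw [h e he]

theorem relCyclic_congr {A F : Set E} {o o' : E → Bool} (h : ∀ e ∈ F, o e = o' e) :
    G.RelCyclic A F o ↔ G.RelCyclic A F o' := by
  rw [RelCyclic, RelCyclic, step_congr h]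
  exact forall₂_congr fun e he => by rw [h e he]

theorem step_insert_right (A F : Set E) (o : E → Bool) (e : E) :
    G.Step A (insert e F) o = AddStep (G.Step A F o) (G.src (o e) e) (G.tgt (o e) e) := by
  ext u v
  simp only [Step, AddStep, Set.mem_insert_iff, or_and_right, exists_or, exists_eq_left, or_assoc,
    eq_comm (a := u), eq_comm (a := v)]
  exact or_congr_right or_comm

theorem step_insert_left (A F : Set E) (o : E → Bool) (b : Bool) (e : E) :
    G.Step (insert e A) F o =
      AddStep (AddStep (G.Step A F o) (G.src b e) (G.tgt b e)) (G.tgt b e) (G.src b e) := by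
  ext u v
  simp only [Step, adj_insert, AddStep]
  cases b <;> simp only [src, tgt] <;> grind

theorem src_step {A F : Set E} {o : E → Bool} {e : E} (he : e ∈ F) :
    G.Step A F o (G.src (o e) e) (G.tgt (o e) e) := Or.inr ⟨e, he, rfl, rfl⟩

/-- A closed walk through `f` that uses `e` can be rotated into one through `e` that uses `f`. -/
theorem relAcyclic_insert_right {A F : Set E} {o : E → Bool} {e : E} :
    G.RelAcyclic A (insert e F) o ↔ G.RelAcyclic A F o ∧
      ¬ ReflTransGen (G.Step A F o) (G.tgt (o e) e) (G.src (o e) e) := by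
  simp only [RelAcyclic, Set.forall_mem_insert, step_insert_right, reflTransGen_addStep]
  constructor
  · rintro ⟨h₁, h₂⟩
    exact ⟨fun f hf h => h₂ f hf (Or.inl h), fun h => h₁ (Or.inl h)⟩
  · rintro ⟨h₁, h₂⟩
    refine ⟨fun h => h₂ (h.elim id And.left), fun f hf h => ?_⟩
    rcases h with h | h
    · exact h₁ f hf h
    · exact h₂ ((h.2.tail (src_step hf)).trans h.1)

/-- A walk either stays in `A` or uses an oriented edge in `F`. -/
theorem reflTransGen_step {A F : Set E} {o : E → Bool} {u v : V}
    (h : ReflTransGen (G.Step A F o) u v) :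
    G.Joined A u v ∨ ∃ f ∈ F, ReflTransGen (G.Step A F o) u (G.src (o f) f) ∧
      ReflTransGen (G.Step A F o) (G.tgt (o f) f) v := by
  induction h with
  | refl => exact Or.inl .refl
  | tail h hs ih =>
    rcases ih with ih | ⟨f, hf, h₁, h₂⟩
    · rcases hs with hs' | ⟨f, hf, rfl, rfl⟩
      · exact Or.inl (ih.tail hs')
      · exact Or.inr ⟨f, hf, h, .refl⟩
    · exact Or.inr ⟨f, hf, h₁, h₂.tail hs⟩

theorem relAcyclic_insert_left_of {A F : Set E} {o : E → Bool} {e : E} (b : Bool)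
    (h : G.RelAcyclic A F o)
    (h₁ : ¬ ReflTransGen (G.Step A F o) (G.src b e) (G.tgt b e))
    (h₂ : ¬ ReflTransGen (G.Step A F o) (G.tgt b e) (G.src b e)) :
    G.RelAcyclic (insert e A) F o := by
  intro f hf hw
  have hs := src_step (G := G) (A := A) (o := o) hf
  rw [step_insert_left A F o b e, reflTransGen_addStep_addStep] at hw
  rcases hw with hw | hw | hw | hw | hw
  · exact h f hf hw
  · exact h₂ ((hw.2.tail hs).trans hw.1)
  · exact h₁ ((hw.2.tail hs).trans hw.1)
  · exact h f hf (hw.1.trans hw.2)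
  · exact h f hf (hw.1.trans hw.2)

theorem joined_src_tgt {A : Set E} (b : Bool) (e : E) :
    G.Joined A (G.src b e) (G.tgt b e) ↔ G.Joined A (G.fst e) (G.snd e) := by
  cases b
  · exact ⟨Joined.symm, Joined.symm⟩
  · exact Iff.rfl

theorem joined_tgt_src {A : Set E} (b : Bool) (e : E) :
    G.Joined A (G.tgt b e) (G.src b e) ↔ G.Joined A (G.fst e) (G.snd e) :=
  ⟨fun h => (joined_src_tgt b e).1 h.symm, fun h => ((joined_src_tgt b e).2 h).symm⟩

theorem RelAcyclic.of_insert_left {A F : Set E} {o : E → Bool} {e : E}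
    (h : G.RelAcyclic (insert e A) F o) : G.RelAcyclic A F o := by
  intro f hf hw
  refine h f hf ?_
  rw [step_insert_left A F o true e, reflTransGen_addStep_addStep]
  exact Or.inl hw

/-- Since `A` does not join the ends of `e`, such a walk uses some `f ∈ F`; the two-way edge `e`
closes it up, contradicting acyclicity. -/
theorem RelAcyclic.not_reflTransGen {A F : Set E} {o : E → Bool} {e : E}
    (h : G.RelAcyclic (insert e A) F o) (he : ¬ G.Joined A (G.fst e) (G.snd e)) (b : Bool) :
    ¬ ReflTransGen (G.Step A F o) (G.tgt b e) (G.src b e) := by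
  intro hw
  rcases reflTransGen_step hw with hj | ⟨f, hf, h₁, h₂⟩
  · exact he ((joined_tgt_src b e).1 hj)
  · refine h f hf ?_
    rw [step_insert_left A F o b e, reflTransGen_addStep_addStep]
    exact Or.inr (Or.inl ⟨h₂, h₁⟩)

/-- Contraction of an edge that is not a loop, for acyclic orientations. -/
theorem relAcyclic_insert_left {A F : Set E} {o : E → Bool} {e : E}
    (he : ¬ G.Joined A (G.fst e) (G.snd e)) :
    G.RelAcyclic (insert e A) F o ↔ G.RelAcyclic A F o ∧
      ¬ ReflTransGen (G.Step A F o) (G.fst e) (G.snd e) ∧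
      ¬ ReflTransGen (G.Step A F o) (G.snd e) (G.fst e) :=
  ⟨fun h => ⟨h.of_insert_left, h.not_reflTransGen he false, h.not_reflTransGen he true⟩,
    fun h => relAcyclic_insert_left_of true h.1 h.2.1 h.2.2⟩

/-- Ensures that at least one orientation of `e` extends a relatively acyclic orientation. -/
theorem RelAcyclic.not_both {A F : Set E} {o : E → Bool} {e : E} (h : G.RelAcyclic A F o)
    (he : ¬ G.Joined A (G.fst e) (G.snd e))
    (h₁ : ReflTransGen (G.Step A F o) (G.fst e) (G.snd e))
    (h₂ : ReflTransGen (G.Step A F o) (G.snd e) (G.fst e)) : False := by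
  rcases reflTransGen_step h₁ with hj | ⟨f, hf, h₃, h₄⟩
  · exact he hj
  · exact h f hf ((h₄.trans h₂).trans h₃)

/-! ### Totally cyclic orientations -/

theorem Step.joined {A F : Set E} {o : E → Bool} {u v : V}
    (h : ReflTransGen (G.Step A F o) u v) : G.Joined (A ∪ F) u v := by
  induction h with
  | refl => exact .refl
  | tail _ hs ih =>
    rcases hs with ⟨e, he, hs⟩ | ⟨e, he, rfl, rfl⟩
    · exact ih.tail ⟨e, Or.inl he, hs⟩
    · exact ih.trans ((joined_src_tgt _ e).2 (joined_of_mem (Or.inr he)))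

/-- The closed walk through an oriented edge lets it be traversed backwards; hence total cyclicity
gives strong connectivity when the graph is connected. -/
theorem RelCyclic.reflTransGen_of_joined {A F : Set E} {o : E → Bool} (h : G.RelCyclic A F o)
    {u v : V} (huv : G.Joined (A ∪ F) u v) : ReflTransGen (G.Step A F o) u v := by
  induction huv with
  | refl => exact .refl
  | tail _ hs ih =>
    obtain ⟨e, he | he, hs⟩ := hs
    · exact ih.tail (Or.inl ⟨e, he, hs⟩)
    · have h₁ := ReflTransGen.single (src_step (G := G) (A := A) (o := o) he)
      have h₂ := h e he
      cases hb : o e <;> rw [hb] at h₁ h₂ <;> rcases hs with ⟨rfl, rfl⟩ | ⟨rfl, rfl⟩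
      · exact ih.trans h₂
      · exact ih.trans h₁
      · exact ih.trans h₁
      · exact ih.trans h₂

/-- Once a return walk for `e` exists, `e` is as good as a two-way edge. -/
theorem relCyclic_insert_right {A F : Set E} {o : E → Bool} {e : E} :
    G.RelCyclic A (insert e F) o ↔
      ReflTransGen (G.Step A F o) (G.tgt (o e) e) (G.src (o e) e) ∧
      G.RelCyclic (insert e A) F o := by
  simp only [RelCyclic, Set.forall_mem_insert, step_insert_right, step_insert_left A F o (o e) e,
    reflTransGen_addStep_addStep]
  simp only [reflTransGen_addStep, or_self_iff, and_self_iff]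
  refine and_congr_right fun h => forall₂_congr fun f _ => ⟨fun hw => hw.imp_right Or.inl, ?_⟩
  rintro (hw | hw | hw | hw | hw)
  · exact Or.inl hw
  · exact Or.inr hw
  · exact Or.inl ((hw.1.trans h).trans hw.2)
  · exact Or.inl (hw.1.trans hw.2)
  · exact Or.inl (hw.1.trans hw.2)

theorem RelCyclic.insert_left {A F : Set E} {o : E → Bool} (h : G.RelCyclic A F o) (e : E) :
    G.RelCyclic (insert e A) F o := by
  intro f hf
  rw [step_insert_left A F o true e, reflTransGen_addStep_addStep]
  exact Or.inl (h f hf)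

/-- If both orientations of `e` work, then `e` is not needed. -/
theorem RelCyclic.of_insert_left {A F : Set E} {o : E → Bool} {e : E}
    (h : G.RelCyclic (insert e A) F o)
    (h₁ : ReflTransGen (G.Step A F o) (G.fst e) (G.snd e))
    (h₂ : ReflTransGen (G.Step A F o) (G.snd e) (G.fst e)) : G.RelCyclic A F o := by
  intro f hf
  have hw := h f hf
  rw [step_insert_left A F o true e, reflTransGen_addStep_addStep] at hw
  rcases hw with hw | hw | hw | hw | hw
  · exact hw
  · exact (hw.1.trans h₁).trans hw.2
  · exact (hw.1.trans h₂).trans hw.2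
  · exact hw.1.trans hw.2
  · exact hw.1.trans hw.2

/-- If `e` is not a bridge, then one of its orientations works. -/
theorem RelCyclic.reflTransGen_or {A F : Set E} {o : E → Bool} {e : E}
    (h : G.RelCyclic (insert e A) F o) (he : G.Joined (A ∪ F) (G.fst e) (G.snd e)) :
    ReflTransGen (G.Step A F o) (G.fst e) (G.snd e) ∨
      ReflTransGen (G.Step A F o) (G.snd e) (G.fst e) := by
  by_contra! hcon
  obtain ⟨h₁, h₂⟩ := hcon
  -- Reachability from `G.fst e` spreads along undirected walks: an edge met against its orientation
  -- is bypassed by its return walk, and the ways that walk could use `e` either contradict `h₁` or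
  -- `h₂` or still reach the vertex.
  suffices ∀ v, G.Joined (A ∪ F) (G.fst e) v → ReflTransGen (G.Step A F o) (G.fst e) v from
    h₁ (this _ he)
  intro v hv
  induction hv with
  | refl => exact .refl
  | @tail v w _ hs ih =>
    obtain ⟨f, hf | hf, hs⟩ := hs
    · exact ih.tail (Or.inl ⟨f, hf, hs⟩)
    · have hst := src_step (G := G) (A := A) (o := o) hf
      have hw := h f hf
      have : (G.src (o f) f = v ∧ G.tgt (o f) f = w) ∨ (G.tgt (o f) f = v ∧ G.src (o f) f = w) := by
        cases o f
        · exact hs.symm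
        · exact hs
      rcases this with ⟨rfl, rfl⟩ | ⟨rfl, rfl⟩
      · exact ih.tail hst
      · rw [step_insert_left A F o true e, reflTransGen_addStep_addStep] at hw
        rcases hw with hw | hw | hw | hw | hw
        · exact ih.trans hw
        · exact absurd ((hw.2.tail hst).trans hw.1) h₂
        · exact absurd (ih.trans hw.1) h₁
        · exact hw.2
        · exact absurd (ih.trans hw.1) h₁

end Multigraph

end

/-! ### Counting orientations by deletion-contraction, and comparison with the coefficients. -/

section

namespace Multigraph

open Relation

variable {V E : Type*} {G : Multigraph V E}

/-! ### Deletion and contraction -/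

/-- The orientation of all edges that follows the reference direction exactly on `O`. -/
def orient [DecidableEq E] (O : Finset E) (e : E) : Bool := decide (e ∈ O)

theorem orient_of_notMem [DecidableEq E] {O : Finset E} {e : E} (h : e ∉ O) :
    orient O e = false := by simp [orient, h]

theorem orient_insert_self [DecidableEq E] (O : Finset E) (e : E) :
    orient (insert e O) e = true := by simp [orient]

theorem orient_insert_of_notMem [DecidableEq E] {F : Finset E} (O : Finset E) {e : E}
    (he : e ∉ F) : ∀ f ∈ (F : Set E), orient (insert e O) f = orient O f := by
  intro f hf
  have : f ≠ e := fun h => he (h ▸ hf)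
  simp [orient, this]

open Classical in
/-- The relatively acyclic orientations are counted by an alternating sum of signs of ranks. -/
theorem sum_relAcyclic [Finite E] [DecidableEq E] {M : Matroid E} (hM : G.IsCycleMatroid M) (F : Finset E) :
    ∀ A : Set E, ∑ S ∈ F.powerset, (-1 : ℤ) ^ (S.card + rk M A + rk M (A ∪ S)) =
      ∑ O ∈ F.powerset, if G.RelAcyclic A F (orient O) then 1 else 0 := by
  induction F using Finset.induction_on with
  | empty =>
    intro A
    simp [RelAcyclic, ← two_mul]
  | insert e F he ih =>
    intro A
    rw [Finset.sum_powerset_insert he, Finset.sum_powerset_insert he]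
    have hc : ∀ S ∈ F.powerset, (insert e S).card = S.card + 1 := fun S hS =>
      Finset.card_insert_of_notMem fun h => he (Finset.mem_powerset.1 hS h)
    have hu : ∀ S : Finset E, A ∪ ((insert e S : Finset E) : Set E) = insert e (A ∪ S) := by
      intro S
      rw [Finset.coe_insert, Set.union_insert]
    -- If `A` joins the ends of `e`, no orientation is acyclic, and the terms for `S` and `insert e
    -- S` cancel.
    by_cases hj : G.Joined A (G.fst e) (G.snd e)
    · have hl : ∀ o, ¬ G.RelAcyclic A (insert e F : Finset E) o := by
        intro o h
        rw [Finset.coe_insert, relAcyclic_insert_right] at h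
        exact h.2 (ReflTransGen.mono (fun _ _ h => Or.inl h) _ _ ((joined_tgt_src _ e).2 hj))
      simp only [hl, if_false, Finset.sum_const_zero, add_zero]
      rw [← Finset.sum_add_distrib]
      refine Finset.sum_eq_zero fun S hS => ?_
      rw [hc S hS, hu, hM.rk_insert_of_joined (hj.mono Set.subset_union_left)]
      ring
    · have h2 : ∀ S ∈ F.powerset,
          (-1 : ℤ) ^ ((insert e S).card + rk M A + rk M (A ∪ (insert e S : Finset E))) =
            (-1) ^ (S.card + rk M (insert e A) + rk M (insert e A ∪ S)) := by
        intro S hS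
        rw [hc S hS, hu, hM.rk_insert_of_not_joined hj, Set.insert_union]
        ring
      rw [Finset.sum_congr rfl h2, ih, ih, ← Finset.sum_add_distrib, ← Finset.sum_add_distrib]
      refine Finset.sum_congr rfl fun O hO => ?_
      have heO : e ∉ O := fun h => he (Finset.mem_powerset.1 hO h)
      rw [Finset.coe_insert, relAcyclic_insert_right, relAcyclic_insert_right,
        relAcyclic_congr (orient_insert_of_notMem O he), step_congr (orient_insert_of_notMem O he),
        orient_of_notMem heO, orient_insert_self, relAcyclic_insert_left hj]
      -- For fixed `O`, the number of admissible directions of `e` is one for `RelAcyclic A F`, plus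
      -- one more if contracting `e` stays acyclic.
      have hb := fun h => RelAcyclic.not_both (A := A) (F := F) (o := orient O) h hj
      simp only [src, tgt, if_true, Bool.false_eq_true, if_false]
      split_ifs <;> tauto

open Classical in
/-- The relatively totally cyclic orientations are counted by an alternating sum of signs of
ranks. -/
theorem sum_relCyclic [Finite E] [DecidableEq E] {M : Matroid E} (hM : G.IsCycleMatroid M) (F : Finset E) :
    ∀ A : Set E, ∑ S ∈ F.powerset, (-1 : ℤ) ^ (rk M (A ∪ F) + rk M (A ∪ S)) =
      ∑ O ∈ F.powerset, if G.RelCyclic A F (orient O) then 1 else 0 := by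
  induction F using Finset.induction_on with
  | empty =>
    intro A
    simp [RelCyclic, ← two_mul]
  | insert e F he ih =>
    intro A
    rw [Finset.sum_powerset_insert he, Finset.sum_powerset_insert he]
    have hu : ∀ S : Finset E, A ∪ ((insert e S : Finset E) : Set E) = insert e (A ∪ S) := by
      intro S
      rw [Finset.coe_insert, Set.union_insert]
    by_cases hj : G.Joined (A ∪ F) (G.fst e) (G.snd e)
    · have h1 : rk M (A ∪ (insert e F : Finset E)) = rk M (A ∪ F) := by
        rw [hu, hM.rk_insert_of_joined hj]
      have h2 : ∀ S ∈ F.powerset,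
          (-1 : ℤ) ^ (rk M (A ∪ (insert e F : Finset E)) + rk M (A ∪ (insert e S : Finset E))) =
            (-1) ^ (rk M (insert e A ∪ F) + rk M (insert e A ∪ S)) := by
        intro S hS
        rw [hu, hu, Set.insert_union, Set.insert_union]
      rw [Finset.sum_congr rfl h2, h1, ih, ih, ← Finset.sum_add_distrib, ← Finset.sum_add_distrib]
      refine Finset.sum_congr rfl fun O hO => ?_
      have heO : e ∉ O := fun h => he (Finset.mem_powerset.1 hO h)
      rw [Finset.coe_insert, relCyclic_insert_right, relCyclic_insert_right,
        relCyclic_congr (orient_insert_of_notMem O he), step_congr (orient_insert_of_notMem O he),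
        orient_of_notMem heO, orient_insert_self]
      simp only [src, tgt, if_true, Bool.false_eq_true, if_false]
      -- Both directions of `e` work if `F` is already cyclic relative to `A`; exactly one works if
      -- this holds only after contracting `e`; otherwise none.
      by_cases hC : G.RelCyclic A F (orient O)
      · simp [hC, hC.insert_left e, hC.reflTransGen_of_joined hj,
          hC.reflTransGen_of_joined hj.symm]
      by_cases hC' : G.RelCyclic (insert e A) F (orient O)
      · have hb := fun h₁ h₂ => hC (hC'.of_insert_left h₁ h₂)
        rcases hC'.reflTransGen_or hj with h | h
        · simpa [hC, hC', h] using hb h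
        · simpa [hC, hC', h] using fun h' => hb h' h
      · simp [hC, hC']
    · have hl : ∀ o, ¬ G.RelCyclic A (insert e F : Finset E) o := by
        intro o h
        rw [Finset.coe_insert, relCyclic_insert_right] at h
        exact hj ((joined_tgt_src _ e).1 (Step.joined h.1))
      simp only [hl, if_false, Finset.sum_const_zero, add_zero]
      rw [← Finset.sum_add_distrib]
      refine Finset.sum_eq_zero fun S hS => ?_
      have hjS : ¬ G.Joined (A ∪ S) (G.fst e) (G.snd e) := fun h =>
        hj (h.mono (Set.union_subset_union_right A
          (Finset.coe_subset.2 (Finset.mem_powerset.1 hS))))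
      rw [hu, hu, hM.rk_insert_of_not_joined hjS]
      ring

/-! ### Comparison with orientations of the complement of `A` -/

/-- Edges of `A` become oriented one at a time. In a forest the remaining two-way edges never join
the ends of the current one, so neither direction closes a walk. -/
theorem RelAcyclic.empty_of_isForest [DecidableEq E] {o : E → Bool} (A : Finset E)
    (hA : G.IsForest A) :
    ∀ {F : Set E}, G.RelAcyclic A F o → G.RelAcyclic ∅ (A ∪ F) o := by
  induction A using Finset.induction_on with
  | empty =>
    intro F h
    simpa using h
  | insert a A ha ih =>
    intro F h
    rw [Finset.coe_insert] at h hA ⊢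
    have hj : ¬ G.Joined A (G.fst a) (G.snd a) := by
      simpa [ha] using hA a (Set.mem_insert _ _)
    rw [Set.insert_union, ← Set.union_insert]
    exact ih (hA.subset (Set.subset_insert _ _))
      (relAcyclic_insert_right.2 ⟨h.of_insert_left, h.not_reflTransGen hj _⟩)

/-- Applying the induction hypothesis to both directions of `a` excludes walks between its ends
either way, so `a` can be made two-way. -/
theorem relAcyclic_of_forall [DecidableEq E] (A : Finset E) :
    ∀ {F : Set E} {o : E → Bool}, Disjoint (A : Set E) F →
      (∀ o' : E → Bool, (∀ e ∉ A, o' e = o e) → G.RelAcyclic ∅ (A ∪ F) o') →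
      G.RelAcyclic A F o := by
  induction A using Finset.induction_on with
  | empty =>
    intro F o _ h
    simpa using h o fun _ _ => rfl
  | insert a A ha ih =>
    intro F o hd h
    rw [Finset.coe_insert, Set.disjoint_insert_left] at hd
    have hu : ∀ b, ∀ f ∈ F, Function.update o a b f = o f := fun b f hf =>
      Function.update_of_ne (fun hfa : f = a => hd.1 (hfa ▸ hf)) _ _
    have key : ∀ b, G.RelAcyclic A F o ∧
        ¬ ReflTransGen (G.Step A F o) (G.tgt b a) (G.src b a) := by
      intro b
      have : G.RelAcyclic A (insert a F) (Function.update o a b) := by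
        refine ih (Set.disjoint_insert_right.2 ⟨ha, hd.2⟩) fun o' ho' => ?_
        rw [Set.union_insert, ← Set.insert_union, ← Finset.coe_insert]
        refine h o' fun e he => ?_
        rw [Finset.mem_insert, not_or] at he
        rw [ho' e he.2, Function.update_of_ne he.1]
      rw [relAcyclic_insert_right, relAcyclic_congr (hu b), step_congr (hu b),
        Function.update_self] at this
      exact this
    rw [Finset.coe_insert]
    exact relAcyclic_insert_left_of true (key true).1 (key false).2 (key true).2

theorem step_empty_univ (o : E → Bool) :
    G.Step ∅ Set.univ o = fun u w => ∃ e, G.GoesFromTo e (o e) u w := by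
  ext u v
  simp [Step, Adj, goesFromTo_iff]

theorem isAcyclicOrientation_iff (o : E → Bool) :
    G.IsAcyclicOrientation o ↔ G.RelAcyclic ∅ Set.univ o := by
  rw [IsAcyclicOrientation, ← step_empty_univ]
  constructor
  · intro h e _ hw
    exact h _ (TransGen.head' (src_step (Set.mem_univ e)) hw)
  · intro h v hv
    obtain ⟨w, ⟨e, he, _⟩ | ⟨e, _, rfl, rfl⟩, hw⟩ := TransGen.head'_iff.1 hv
    · exact he
    · exact h e (Set.mem_univ e) hw

open Classical in
theorem card_orientations [Fintype E] [DecidableEq E] (A : Finset E)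
    (P : ({e // e ∉ (A : Set E)} → Bool) → Prop) (Q : Finset E → Prop)
    (h : ∀ O : Finset E, P (fun e => orient O e.1) ↔ Q O) :
    (Nat.card {o // P o} : ℤ) = ∑ O ∈ (Aᶜ).powerset, if Q O then 1 else 0 := by
  simp only [← h]
  rw [Finset.sum_boole, Nat.cast_inj, Nat.card_eq_fintype_card, Fintype.card_subtype]
  symm
  refine Finset.card_bij (fun O _ e => orient O e) (fun O hO => ?_) (fun O hO O' hO' h => ?_)
    fun o ho => ?_
  · simpa using (Finset.mem_filter.1 hO).2
  · have hs := Finset.mem_powerset.1 (Finset.mem_filter.1 hO).1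
    have hs' := Finset.mem_powerset.1 (Finset.mem_filter.1 hO').1
    ext e
    by_cases he : e ∈ A
    · exact iff_of_false (fun h => Finset.mem_compl.1 (hs h) he)
        fun h => Finset.mem_compl.1 (hs' h) he
    · simpa [orient] using congrFun h ⟨e, by simpa using he⟩
  · have heq : (fun e : {e // e ∉ (A : Set E)} =>
        orient (Finset.univ.filter fun e => ∃ h : e ∉ (A : Set E), o ⟨e, h⟩ = true) e.1) = o := by
      ext ⟨e, he⟩
      simp only [orient, Finset.mem_filter, Finset.mem_univ, true_and]
      simp [he]
    refine ⟨Finset.univ.filter fun e => ∃ h : e ∉ (A : Set E), o ⟨e, h⟩ = true, ?_, heq⟩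
    rw [Finset.mem_filter, heq, Finset.mem_powerset]
    refine ⟨fun e he => ?_, by simpa using ho⟩
    obtain ⟨h, -⟩ := (Finset.mem_filter.1 he).2
    simpa using h

open Classical in
theorem numAcyclic_eq_sum [Fintype E] [DecidableEq E] (A : Finset E) (hA : G.IsForest A) :
    (G.numAcyclic A : ℤ) =
      ∑ O ∈ (Aᶜ).powerset, if G.RelAcyclic A (Aᶜ : Finset E) (orient O) then 1 else 0 := by
  refine card_orientations A _ _ fun O => ?_
  have hu : (A : Set E) ∪ (Aᶜ : Finset E) = Set.univ := by simp
  simp only [isAcyclicOrientation_iff, ← hu, Subtype.forall]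
  constructor
  · exact relAcyclic_of_forall A (by simp [disjoint_compl_right])
  · intro h o' ho'
    refine RelAcyclic.empty_of_isForest A hA ((relAcyclic_congr fun e he => ?_).2 h)
    exact ho' e (by simpa using he)

open Classical in
theorem numStronglyConnected_eq_sum [Fintype E] [DecidableEq E] (A : Finset E)
    (hG : G.Connected) :
    (G.numStronglyConnected A : ℤ) =
      ∑ O ∈ (Aᶜ).powerset, if G.RelCyclic A (Aᶜ : Finset E) (orient O) then 1 else 0 := by
  refine card_orientations A _ _ fun O => ?_
  have hs : (fun u w => (∃ e : {e // e ∉ (A : Set E)}, G.GoesFromTo e (orient O e) u w) ∨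
      G.Adj A u w) = G.Step A (Aᶜ : Finset E) (orient O) := by
    ext u w
    simp [Step, goesFromTo_iff, or_comm, and_left_comm (a := _ ∉ _)]
  rw [hs]
  refine ⟨fun h e _ => h _ _, fun h u v => h.reflTransGen_of_joined ?_⟩
  simpa using hG u v

end Multigraph

/-! ### Coefficients of the evaluations -/

variable {E : Type*} [Fintype E] [DecidableEq E]

omit [Fintype E] in
theorem coeff_prod_one_add_X (A S : Finset E) :
    coeff (∑ e ∈ A, Finsupp.single e 1) (∏ e ∈ S, (1 + X e : MvPolynomial E ℤ)) =
      if A ⊆ S then 1 else 0 := by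
  have hm : ∀ T : Finset E, (∏ e ∈ T, X e : MvPolynomial E ℤ) =
      monomial (∑ e ∈ T, Finsupp.single e 1) 1 := fun T => by
    simp [monomial_sum_one, X]
  have hi : ∀ T : Finset E, (∑ e ∈ T, Finsupp.single e 1 : E →₀ ℕ) =
      ∑ e ∈ A, Finsupp.single e 1 ↔ T = A := by
    refine fun T => ⟨fun h => ?_, fun h => by rw [h]⟩
    ext e
    have := DFunLike.congr_fun h e
    simp only [Finsupp.finsetSum_apply, Finsupp.single_apply, Finset.sum_ite_eq'] at this
    by_cases h₁ : e ∈ T <;> by_cases h₂ : e ∈ A <;> simp_all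
  simp [Finset.prod_one_add, coeff_sum, hm, coeff_monomial, hi]

/-- At `r = 1`, `s = 0` only sets containing `A` contribute to `t_A`; they are indexed by their part
outside `A`. -/
theorem evalCoeff_eq_sum (x y : ℤ) (A : Finset E) (M : Matroid E) :
    evalCoeff ![x, y, 1, 0] A M = ∑ S ∈ (Aᶜ).powerset,
      (x - 1) ^ (rk M Set.univ - rk M (A ∪ S)) * (y - 1) ^ (A.card + S.card - rk M (A ∪ S)) := by
  have h : evalTutte ![x, y, 1, 0] M = ∑ S : Finset E,
      C ((x - 1) ^ (rk M Set.univ - rk M S) * (y - 1) ^ (S.card - rk M S)) *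
        ∏ e ∈ S, (1 + X e) := by
    simp [evalTutte, equivTutte]
  rw [evalCoeff, h, coeff_sum]
  simp only [coeff_C_mul, coeff_prod_one_add_X, mul_ite, mul_one, mul_zero]
  rw [← Finset.sum_filter]
  refine Finset.sum_nbij' (fun S => S \ A) (fun S => A ∪ S) ?_ ?_ ?_ ?_ ?_
  · intro S _
    simp [Finset.subset_iff]
  · intro S _
    simp
  · intro S hS
    exact Finset.union_sdiff_of_subset (Finset.mem_filter.1 hS).2
  · intro S hS
    have : Disjoint S A := Finset.subset_compl_iff_disjoint_right.1 (Finset.mem_powerset.1 hS)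
    rw [Finset.union_sdiff_cancel_left this.symm]
  · intro S hS
    have hAS := (Finset.mem_filter.1 hS).2
    rw [← Finset.coe_union, Finset.union_sdiff_of_subset hAS, add_comm A.card,
      Finset.card_sdiff_add_card_eq_card hAS]

theorem neg_one_pow_sub_eq_add {m n : ℕ} (h : m ≤ n) : (-1 : ℤ) ^ (n - m) = (-1) ^ (n + m) := by
  obtain ⟨d, rfl⟩ := Nat.exists_eq_add_of_le h
  rw [Nat.add_sub_cancel_left, show m + d + m = 2 * m + d by ring, pow_add, pow_mul]
  simp

theorem rk_le_card {E : Type*} [Fintype E] (M : Matroid E) (S : Finset E) : rk M S ≤ S.card := by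
  have := M.eRk_le_encard S
  rw [← cast_rk, Set.encard_coe_eq_coe_finsetCard] at this
  exact_mod_cast this

theorem evalCoeff_eq_numAcyclic {V : Type*} {G : Multigraph V E} {M : Matroid E}
    (hM : G.IsCycleMatroid M) (A : Finset E) (hA : M.Indep A) :
    evalCoeff ![2, 0, 1, 0] A M = G.numAcyclic A := by
  rw [evalCoeff_eq_sum, Multigraph.numAcyclic_eq_sum A ((hM.2 A).1 hA),
    ← Multigraph.sum_relAcyclic hM]
  refine Finset.sum_congr rfl fun S hS => ?_
  have hd : Disjoint A S :=
    (Finset.subset_compl_iff_disjoint_right.1 (Finset.mem_powerset.1 hS)).symm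
  have := rk_le_card M (A ∪ S)
  rw [Finset.coe_union, Finset.card_union_of_disjoint hd] at this
  -- Independence of `A` replaces `rk M A` by `A.card`, which makes the two signs agree.
  rw [(indep_iff_rk M A).1 hA, zero_sub, neg_one_pow_sub_eq_add this, add_comm A.card]
  norm_num

theorem evalCoeff_eq_numStronglyConnected {V : Type*} {G : Multigraph V E} {M : Matroid E}
    (hM : G.IsCycleMatroid M) (hG : G.Connected) (A : Finset E) :
    evalCoeff ![0, 2, 1, 0] A M = G.numStronglyConnected A := by
  rw [evalCoeff_eq_sum, Multigraph.numStronglyConnected_eq_sum A hG, ← Multigraph.sum_relCyclic hM]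
  refine Finset.sum_congr rfl fun S _ => ?_
  rw [zero_sub, neg_one_pow_sub_eq_add (rk_mono M (Set.subset_univ _)), Finset.coe_compl,
    Set.union_compl_self]
  norm_num

end

end EquivariantTutte

open EquivariantTutte in
theorem mainTheorem3 {E : Type*} [Fintype E] [DecidableEq E] (k : ℕ) :
    -- the equivariant Tutte polynomial
    ExtendsToValuative (fun M : RankMatroid E k => equivTutte M.1) ∧
    -- the multivariate Tutte polynomial
    (∀ (R : Type*) [CommRing R] (q : Rˣ),
      ExtendsToValuative (fun M : RankMatroid E k => multivariateTutte q M.1)) ∧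
    -- the evaluations in the table, and their coefficients
    (∀ a ∈ tablePoints, ExtendsToValuative (fun M : RankMatroid E k => evalTutte a M.1)) ∧
    (∀ a ∈ tablePoints, ∀ A : Finset E,
      ExtendsToValuative (fun M : RankMatroid E k => evalCoeff a A M.1)) ∧
    -- the combinatorial entries of the table
    (∀ A : Finset E,
      ExtendsToValuative (fun M : RankMatroid E k =>
        (({B : Set E | M.1.IsBase B ∧ (A : Set E) ⊆ B}.ncard : ℕ) : ℤ)) ∧
      ExtendsToValuative (fun _ : RankMatroid E k => (2 : ℤ) ^ (Aᶜ).card) ∧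
      ExtendsToValuative (fun M : RankMatroid E k =>
        (({I : Set E | M.1.Indep I ∧ (A : Set E) ⊆ I}.ncard : ℕ) : ℤ)) ∧
      ExtendsToValuative (fun M : RankMatroid E k =>
        (({S : Set E | M.1.Spanning S ∧ Disjoint S (A : Set E)}.ncard : ℕ) : ℤ)) ∧
      (∃ f : Mat E k →+ ℤ, IsValuative f ∧
        (∀ M, f (Finsupp.single M 1) = evalCoeff ![2, 0, 1, 0] A M.1) ∧
        ∀ (V : Type*) [Finite V] (G : Multigraph V E) (M : RankMatroid E k),
          G.IsCycleMatroid M.1 → M.1.Indep (A : Set E) →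
            f (Finsupp.single M 1) = (G.numAcyclic (A : Set E) : ℤ)) ∧
      (∃ f : Mat E k →+ ℤ, IsValuative f ∧
        (∀ M, f (Finsupp.single M 1) = evalCoeff ![0, 2, 1, 0] A M.1) ∧
        ∀ (V : Type*) [Finite V] (G : Multigraph V E) (M : RankMatroid E k),
          G.IsCycleMatroid M.1 → G.Connected →
            f (Finsupp.single M 1) = (G.numStronglyConnected (A : Set E) : ℤ))) := by
  refine ⟨extendsToValuative_equivTutte, fun R _ q => extendsToValuative_multivariateTutte q,
    fun a _ => extendsToValuative_evalTutte a, fun a _ A => extendsToValuative_evalCoeff a A,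
    fun A => ⟨?_, extendsToValuative_const _, ?_, ?_, ?_, ?_⟩⟩
  · refine extendsToValuative_ncard (fun M B => M.1.IsBase B ∧ (A : Set E) ⊆ B)
      (fun S j => (j = S.card ∧ j = k) ∧ A ⊆ S) fun M S => ?_
    have hB : M.1.IsBase S ↔ M.1.Indep S ∧ M.1.Spanning S :=
      ⟨fun h => ⟨h.indep, h.spanning⟩, fun h => h.1.isBase_of_spanning h.2⟩
    rw [hB, indep_iff_rk, M.spanning_iff_rk, Finset.coe_subset]
  · refine extendsToValuative_ncard (fun M I => M.1.Indep I ∧ (A : Set E) ⊆ I)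
      (fun S j => j = S.card ∧ A ⊆ S) fun M S => ?_
    rw [indep_iff_rk, Finset.coe_subset]
  · refine extendsToValuative_ncard (fun M S => M.1.Spanning S ∧ Disjoint S (A : Set E))
      (fun S j => j = k ∧ Disjoint S A) fun M S => ?_
    rw [M.spanning_iff_rk, Finset.disjoint_coe]
  · obtain ⟨f, hf, hv⟩ := extendsToValuative_evalCoeff (k := k) ![2, 0, 1, 0] A
    exact ⟨f, hv, hf, fun V _ G M hM hA => (hf M).trans (evalCoeff_eq_numAcyclic hM A hA)⟩
  · obtain ⟨f, hf, hv⟩ := extendsToValuative_evalCoeff (k := k) ![0, 2, 1, 0] A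
    exact ⟨f, hv, hf, fun V _ G M hM hG =>
      (hf M).trans (evalCoeff_eq_numStronglyConnected hM hG A)⟩
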